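/- Let $p$ be an odd prime, $e\ge 1$, $q=p^e$, and let $l$ be an integer with $2l\mid e$. For $\mathbf x,\mathbf y\in\mathbb F_q^N$ put $(\mathbf x,\mathbf y)_l=\sum_{i=1}^N x_iy_i^{p^l}$; the $l$-Galois dual of a linear code $\mathcal C\subseteq\mathbb F_q^N$ is $\mathcal C^{\perp_l}=\{\mathbf x\in\mathbb F_q^N:(\mathbf y,\mathbf x)_l=0\text{ for all }\mathbf y\in\mathcal C\}$, and its $l$-Galois hull is $\mathcal C\cap\mathcal C^{\perp_l}$. An $[N,k]_q$ MDS code is a $k$-dimensional linear code of length $N$ over $\mathbb F_q$ whose minimum Hamming distance is $N+1-k$. For distinct $a_1,\dots,a_m\in\mathbb F_q$ and $v_1,\dots,v_m\in\mathbb F_q^*$ put $$GRS_k(\mathbf a,\mathbf v)=\{(v_1f(a_1),\dots,v_mf(a_m)) : f\in\mathbb F_q[x],\ \deg f\le k-1\},$$ $$GRS_k(\mathbf a,\mathbf v,\infty)=\{(v_1f(a_1),\dots,v_mf(a_m),f_{k-1}) : f\in\mathbb F_q[x],\ \deg f\le k-1\},$$ where $f_{k-1}$ is the coefficient of $x^{k-1}$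 in $f$. Let $x_1,x_2$ be non-negative integers such that $(q-1)\mid\mathrm{lcm}(x_1,x_2)$ and $\frac{q-1}{p^l-1}\mid x_1$. Let $1\le r\le\frac{q-1}{\gcd(x_1,q-1)}$ and $n=\frac{r(q-1)}{\gcd(x_2,q-1)}$. Let $\alpha$ be a primitive element of $\mathbb F_q$, put $\xi_1=\alpha^{x_1}$, $\xi_2=\alpha^{x_2}$, and let $$\mathcal R=\{\xi_1^i\xi_2^j : 1\le i\le r,\ 1\le j\le\mathrm{ord}(\xi_2)\}\subseteq\mathbb F_q^*.$$ Then for every integer $k$ with $1\le k\le\left\lfloor\frac{p^l+n}{p^l+1}\right\rfloor$: (1) for every $0\le h\le k-1$ there exists an $[n,k]_q$ MDS code with $h$-dimensional $l$-Galois hull, of the form $GRS_k(\mathbf a,\mathbf v)$ where $a_1,\dots,a_n$ are the (distinct) elements of $\mathcal R$; (2) for every $0\le h\le k$ there exists an $[n+1,k]_q$ MDS code with $h$-dimensional $l$-Galois hull, of the form $GRS_k(\mathbf a,\mathbf v)$ where $a_1,\dots,a_{n+1}$ are the (distinct) elements of $\mathcal R\cup\{0\}$; (3) for every $0\le h\le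 k-1$ there exists an $[n+2,k]_q$ MDS code with $h$-dimensional $l$-Galois hull, of the form $GRS_k(\mathbf a,\mathbf v,\infty)$ where $a_1,\dots,a_{n+1}$ are the (distinct) elements of $\mathcal R\cup\{0\}$. -/

import Mathlib

/-- The minimum distance of a linear code: the least Hamming distance of two distinct codewords.
(The value is `0` for a code without two distinct codewords.) -/
noncomputable def minDistance {F ι : Type*} [Field F] [DecidableEq F] [Fintype ι]
    (C : Submodule F (ι → F)) : ℕ :=
  sInf {d : ℕ | ∃ x ∈ C, ∃ y ∈ C, x ≠ y ∧ hammingDist x y = d}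

/-- `C` is an `[n, k]` MDS code: it has length `n`, dimension `k`, and its minimum distance `d`
attains the Singleton bound `d = n + 1 - k`. -/
def IsMDSCode {F : Type*} [Field F] [DecidableEq F] (n k : ℕ)
    (C : Submodule F (Fin n → F)) : Prop :=
  Module.finrank F C = k ∧ minDistance C + k = n + 1

/-- The `l`-Galois form `(x, y)_l = ∑ i, x_i * y_i ^ (p ^ l)`. -/
def galoisForm {F ι : Type*} [Field F] [Fintype ι] (p l : ℕ) (x y : ι → F) : F :=
  ∑ i, x i * y i ^ p ^ l

/-- The `l`-Galois dual code `{x | (y, x)_l = 0 for all y ∈ C}`. It is a subspace in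
characteristic `p`. -/
def galoisDual {F ι : Type*} [Field F] [Fintype ι] (p : ℕ) [Fact p.Prime] [CharP F p] (l : ℕ)
    (C : Submodule F (ι → F)) : Submodule F (ι → F) where
  carrier := {x | ∀ y ∈ C, galoisForm p l y x = 0}
  zero_mem' := by
    intro y _
    have h : (0 : F) ^ p ^ l = 0 := zero_pow (pow_ne_zero _ (Fact.out : p.Prime).ne_zero)
    simp only [galoisForm, Pi.zero_apply, h, mul_zero, Finset.sum_const_zero]
  add_mem' := by
    intro a b ha hb y hy
    have h1 := ha y hy
    have h2 := hb y hy
    simp only [galoisForm] at h1 h2 ⊢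
    simp only [Pi.add_apply, add_pow_char_pow, mul_add, Finset.sum_add_distrib, h1, h2, add_zero]
  smul_mem' := by
    intro c a ha y hy
    have h1 := ha y hy
    simp only [galoisForm] at h1 ⊢
    simp only [Pi.smul_apply, smul_eq_mul, mul_pow, mul_left_comm _ (c ^ p ^ l),
      ← Finset.mul_sum, h1, mul_zero]

/-- The `l`-Galois hull of `C`: the intersection of `C` with its `l`-Galois dual. -/
def galoisHull {F ι : Type*} [Field F] [Fintype ι] (p : ℕ) [Fact p.Prime] [CharP F p] (l : ℕ)
    (C : Submodule F (ι → F)) : Submodule F (ι → F) :=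
  C ⊓ galoisDual p l C

/-- The linear map `f ↦ (v_i * f(a_i))_i` on polynomials. -/
noncomputable def grsEval {F ι : Type*} [Field F] (a v : ι → F) :
    Polynomial F →ₗ[F] (ι → F) where
  toFun f := fun i => v i * f.eval (a i)
  map_add' := by
    intro f g
    ext i
    simp [mul_add]
  map_smul' := by
    intro c f
    ext i
    simp [mul_left_comm]

/-- The generalized Reed-Solomon code `GRS_k(a, v)`: all vectors `(v_i * f(a_i))_i`, where `f` is
a polynomial of degree less than `k`. -/
noncomputable def grsCode {F ι : Type*} [Field F] (k : ℕ) (a v : ι → F) :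
    Submodule F (ι → F) :=
  (Polynomial.degreeLT F k).map (grsEval a v)

/-- The linear map `f ↦ (v_1 f(a_1), …, v_m f(a_m), f_{k-1})` on polynomials, where `f_{k-1}` is
the coefficient of `X ^ (k - 1)` in `f`. -/
noncomputable def extGrsEval {F : Type*} [Field F] {m : ℕ} (k : ℕ) (a v : Fin m → F) :
    Polynomial F →ₗ[F] (Fin (m + 1) → F) where
  toFun f := Fin.snoc (α := fun _ => F) (fun i => v i * f.eval (a i)) (f.coeff (k - 1))
  map_add' := by
    intro f g
    ext i
    refine Fin.lastCases ?_ (fun j => ?_) i <;> simp [mul_add]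
  map_smul' := by
    intro c f
    ext i
    refine Fin.lastCases ?_ (fun j => ?_) i <;> simp [mul_left_comm]

/-- The extended generalized Reed-Solomon code `GRS_k(a, v, ∞)`: all vectors
`(v_1 f(a_1), …, v_m f(a_m), f_{k-1})`, where `f` is a polynomial of degree less than `k`. -/
noncomputable def extGrsCode {F : Type*} [Field F] {m : ℕ} (k : ℕ) (a v : Fin m → F) :
    Submodule F (Fin (m + 1) → F) :=
  (Polynomial.degreeLT F k).map (extGrsEval k a v)

/-- The evaluation points `ξ₁ ^ i * ξ₂ ^ j` with `1 ≤ i ≤ r` and `1 ≤ j ≤ ord ξ₂`. -/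
def evalPoints {F : Type*} [Field F] (ξ₁ ξ₂ : Fˣ) (r : ℕ) : Set F :=
  {b | ∃ i j : ℕ, 1 ≤ i ∧ i ≤ r ∧ 1 ≤ j ∧ j ≤ orderOf ξ₂ ∧ b = (ξ₁ : F) ^ i * (ξ₂ : F) ^ j}

/-!
Let `a 0 = 0` and let `a 1, …, a n` be the points of `evalPoints`. The barycentric weights
`u i = ∏_{j ≠ i} (a i - a j)⁻¹` satisfy `∑ u i * P (a i) = 0` for all polynomials `P` of degree less
than `n` (`sum_nodalWeight_mul_eval_eq_zero`). The points other than `0` form `r` cosets of the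
group of order `m` generated by `ξ₂`, so the nodal polynomial of all points is `X * G (X ^ m)` with
`G = ∏ (X - ξ₁ ^ (s * m))`. Since `ξ₁` is fixed by the `l`-th power of the Frobenius, so are `G`, the
powers `a i ^ m`, and hence the `u i`, which are inverse values of the derivative
(`map_nodalWeight_cons_evalPoints`). Elements of the field with `p ^ l` elements are
`(p ^ l + 1)`-th powers in `F`, because `2 * l ∣ e`; write `u i = w i ^ (p ^ l + 1)`.

For `f, g` of degree less than `k`, the polynomial `f * g ^ p ^ l` has degree less than `n` by the
bound on `k`, so with the column multipliers `w` the Galois form vanishes on the code on all `n + 1`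
points. Multiplying the entries of `w` on a set `S` of coordinates by some `β` with
`β ^ (p ^ l + 1) ≠ 1` turns the form into `∑_{i ∈ S} c i * f (a i) * g (a i) ^ p ^ l` with all `c i`
nonzero (`galoisForm_grsEval_rescale`). Omitting the point `0` adds a multiple of
`f 0 * g 0 ^ p ^ l`, and the point at infinity adds the product of the top coefficient of `f` and the
`p ^ l`-th power of that of `g`. In each case the form is diagonal in at most `k` independent
functionals, and the hull is their common kernel (`finrank_galoisHull_range_add_card`); the size of
`S` gives every dimension allowed.
-/

section

open Polynomial

/-! ### Hulls of codes given by an injective encoder -/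

/-- If the Galois form pulls back along the encoder `E` to the diagonal form with nonzero
coefficients `c` in independent functionals `T`, then the hull is the image of `ker T`: testing
against an `f` for which `T f` is a coordinate vector isolates one summand. -/
theorem finrank_galoisHull_range_add_card {F V ι κ : Type*} [Field F] [AddCommGroup V] [Module F V]
    [FiniteDimensional F V] [Fintype ι] [Fintype κ] (p l : ℕ) [Fact p.Prime] [CharP F p]
    (E : V →ₗ[F] ι → F) (hE : Function.Injective E) (T : V →ₗ[F] κ → F)
    (hT : Function.Surjective T) (c : κ → F) (hc : ∀ j, c j ≠ 0)
    (hform : ∀ f g, galoisForm p l (E f) (E g) = ∑ j, c j * T f j * T g j ^ p ^ l) :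
    Module.finrank F (galoisHull p l (LinearMap.range E)) + Fintype.card κ
      = Module.finrank F V := by
  classical
  have hpl : p ^ l ≠ 0 := pow_ne_zero _ (Fact.out : p.Prime).ne_zero
  have hhull : galoisHull p l (LinearMap.range E) = (LinearMap.ker T).map E := by
    ext x
    constructor
    · rintro ⟨⟨g, rfl⟩, hg⟩
      refine ⟨g, ?_, rfl⟩
      rw [SetLike.mem_coe, LinearMap.mem_ker]
      ext j
      obtain ⟨f, hf⟩ := hT (Pi.single j 1)
      have h := hg (E f) ⟨f, rfl⟩
      rw [hform, hf, Finset.sum_eq_single j] at h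
      · rw [Pi.single_eq_same, mul_one] at h
        exact (pow_eq_zero_iff hpl).1 ((mul_eq_zero.1 h).resolve_left (hc j))
      · intro i _ hij
        simp [hij]
      · simp
    · rintro ⟨g, hg, rfl⟩
      refine ⟨⟨g, rfl⟩, ?_⟩
      rintro _ ⟨f, rfl⟩
      rw [SetLike.mem_coe, LinearMap.mem_ker] at hg
      simp only [hform, hg, Pi.zero_apply, zero_pow hpl, mul_zero, Finset.sum_const_zero]
  rw [hhull, ← (Submodule.equivMapOfInjective E hE (LinearMap.ker T)).finrank_eq,
    ← T.finrank_range_add_finrank_ker, LinearMap.range_eq_top.2 hT, finrank_top,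
    Module.finrank_fintype_fun_eq_card, add_comm]

/-- An encoder whose nonzero words have fewer than `k` zeros is injective. -/
theorem injective_of_card_zeros_lt {F V : Type*} [Field F] [DecidableEq F] [AddCommGroup V]
    [Module F V] {N k : ℕ} (hkN : k ≤ N) (E : V →ₗ[F] Fin N → F)
    (hz : ∀ f, f ≠ 0 → (Finset.univ.filter fun i => E f i = 0).card < k) :
    Function.Injective E := by
  rw [← LinearMap.ker_eq_bot, LinearMap.ker_eq_bot']
  intro f hf
  by_contra h0
  have := hz f h0
  simp [hf] at this
  omega

/-- The range of an encoder of rank `k` whose nonzero words have fewer than `k` zeros is MDS; a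
word of minimal weight is one that vanishes on `k - 1` chosen coordinates. -/
theorem isMDSCode_range {F V : Type*} [Field F] [DecidableEq F] [AddCommGroup V] [Module F V]
    [FiniteDimensional F V] {N k : ℕ} (hk : 1 ≤ k) (hkN : k ≤ N) (E : V →ₗ[F] Fin N → F)
    (hV : Module.finrank F V = k)
    (hz : ∀ f, f ≠ 0 → (Finset.univ.filter fun i => E f i = 0).card < k) :
    IsMDSCode N k (LinearMap.range E) := by
  have hE := injective_of_card_zeros_lt hkN E hz
  have hdist : ∀ f g, hammingDist (E f) (E g)
      + (Finset.univ.filter fun i => E (f - g) i = 0).card = N := by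
    intro f g
    have h := Finset.card_filter_add_card_filter_not (s := (Finset.univ : Finset (Fin N)))
      (fun i => E (f - g) i = 0)
    simp only [map_sub, Pi.sub_apply, sub_eq_zero, Finset.card_univ, Fintype.card_fin] at h ⊢
    rw [hammingDist, add_comm]
    exact h
  refine ⟨by rw [LinearMap.finrank_range_of_inj hE, hV], ?_⟩
  have hleast : IsLeast {d : ℕ | ∃ x ∈ LinearMap.range E, ∃ y ∈ LinearMap.range E,
      x ≠ y ∧ hammingDist x y = d} (N + 1 - k) := by
    constructor
    · let ρ : V →ₗ[F] (Fin (k - 1) → F) :=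
        (LinearMap.funLeft F F (Fin.castLE (by omega : k - 1 ≤ N))) ∘ₗ E
      have hker : LinearMap.ker ρ ≠ ⊥ := by
        apply LinearMap.ker_ne_bot_of_finrank_lt
        rw [Module.finrank_fin_fun, hV]
        omega
      obtain ⟨f, hf, hf0⟩ := Submodule.exists_mem_ne_zero_of_ne_bot hker
      refine ⟨E f, ⟨f, rfl⟩, E 0, ⟨0, rfl⟩, hE.ne hf0, ?_⟩
      have h1 := hdist f 0
      have h2 := hz f hf0
      rw [sub_zero] at h1
      have h3 : k - 1 ≤ (Finset.univ.filter fun i => E f i = 0).card := by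
        have h4 : (Finset.univ.map (Fin.castLEEmb (by omega : k - 1 ≤ N)))
            ⊆ (Finset.univ.filter fun i => E f i = 0) := by
          intro i hi
          obtain ⟨j, -, rfl⟩ := Finset.mem_map.1 hi
          simpa [ρ] using congrFun (LinearMap.mem_ker.1 hf) j
        simpa using Finset.card_le_card h4
      omega
    · rintro d ⟨_, ⟨f, rfl⟩, _, ⟨g, rfl⟩, hne, rfl⟩
      have h1 := hdist f g
      have h2 := hz (f - g) (sub_ne_zero.2 fun h => hne (h ▸ rfl))
      omega
  rw [minDistance, hleast.csInf_eq]
  omega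

/-! ### Evaluation of polynomials of bounded degree -/

theorem finrank_degreeLT (F : Type*) [Field F] (k : ℕ) :
    Module.finrank F (degreeLT F k) = k := by
  rw [(degreeLTEquiv F k).finrank_eq, Module.finrank_fin_fun]

instance finiteDimensional_degreeLT (F : Type*) [Field F] (k : ℕ) :
    FiniteDimensional F (degreeLT F k) :=
  (degreeLTEquiv F k).symm.finiteDimensional

theorem card_eval_eq_zero_le_natDegree {F ι : Type*} [Field F] [DecidableEq F] [Fintype ι]
    {a : ι → F} (ha : Function.Injective a) {f : F[X]} (hf : f ≠ 0) :
    (Finset.univ.filter fun i => f.eval (a i) = 0).card ≤ f.natDegree := by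
  rw [← Finset.card_image_of_injective _ ha]
  refine (Finset.card_le_card (t := f.roots.toFinset) ?_).trans
    ((Multiset.toFinset_card_le _).trans (card_roots' f))
  intro x hx
  obtain ⟨i, hi, rfl⟩ := Finset.mem_image.1 hx
  simpa [hf] using hi

theorem card_zeros_grsEval_lt {F ι : Type*} [Field F] [DecidableEq F] [Fintype ι] {k : ℕ}
    {a v : ι → F} (ha : Function.Injective a) (hv : ∀ i, v i ≠ 0) {f : F[X]}
    (hfk : f ∈ degreeLT F k) (hf : f ≠ 0) :
    (Finset.univ.filter fun i => grsEval a v f i = 0).card < k := by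
  have h := card_eval_eq_zero_le_natDegree ha hf
  have h' : f.natDegree < k := (natDegree_lt_iff_degree_lt hf).2 (mem_degreeLT.1 hfk)
  simp only [grsEval, LinearMap.coe_mk, AddHom.coe_mk, mul_eq_zero, hv, false_or]
  exact h.trans_lt h'

/-- A zero of the last coordinate lowers the degree bound by one, which makes up for it. -/
theorem card_zeros_extGrsEval_lt {F : Type*} [Field F] [DecidableEq F] {m k : ℕ}
    {a v : Fin m → F} (ha : Function.Injective a) (hv : ∀ i, v i ≠ 0) {f : F[X]}
    (hfk : f ∈ degreeLT F k) (hf : f ≠ 0) :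
    (Finset.univ.filter fun i => extGrsEval k a v f i = 0).card < k := by
  have h := card_eval_eq_zero_le_natDegree ha hf
  have h' : f.natDegree < k := (natDegree_lt_iff_degree_lt hf).2 (mem_degreeLT.1 hfk)
  rw [Finset.card_filter] at h ⊢
  rw [Fin.sum_univ_castSucc]
  simp only [extGrsEval, LinearMap.coe_mk, AddHom.coe_mk, Fin.snoc_castSucc, Fin.snoc_last,
    mul_eq_zero, hv, false_or]
  split_ifs with hc
  · have h2 : f.natDegree ≠ k - 1 := by
      rintro h3
      rw [← h3] at hc
      exact hf (leadingCoeff_eq_zero.1 hc)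
    omega
  · omega

/-- Evaluation at a finite family of points, on polynomials of degree less than `k`. -/
noncomputable def evalDegreeLT {F κ : Type*} [Field F] (k : ℕ) (b : κ → F) :
    degreeLT F k →ₗ[F] κ → F :=
  LinearMap.pi fun j => (leval (b j)).domRestrict (degreeLT F k)

theorem exists_degreeLT_eval_eq {F κ : Type*} [Field F] [Fintype κ] {b : κ → F}
    (hb : Function.Injective b) (y : κ → F) :
    ∃ f ∈ degreeLT F (Fintype.card κ), ∀ j, f.eval (b j) = y j := by
  classical
  exact ⟨Lagrange.interpolate Finset.univ b y,
    mem_degreeLT.2 (Lagrange.degree_interpolate_lt y hb.injOn),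
    fun j => Lagrange.eval_interpolate_at_node y hb.injOn (Finset.mem_univ j)⟩

theorem evalDegreeLT_surjective {F κ : Type*} [Field F] [Fintype κ] {k : ℕ} {b : κ → F}
    (hb : Function.Injective b) (hk : Fintype.card κ ≤ k) :
    Function.Surjective (evalDegreeLT k b) := by
  intro y
  obtain ⟨f, hf, hfy⟩ := exists_degreeLT_eval_eq hb y
  exact ⟨⟨f, degreeLT_mono hk hf⟩, funext hfy⟩

/-- The coefficient of `X ^ (k - 1)`, indexed by `none`, together with the values at a finite
family of points, on polynomials of degree less than `k`. -/
noncomputable def coeffEvalDegreeLT {F κ : Type*} [Field F] (k : ℕ) (b : κ → F) :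
    degreeLT F k →ₗ[F] Option κ → F :=
  LinearMap.pi fun j => j.elim ((lcoeff F (k - 1)).domRestrict (degreeLT F k))
    fun j => (leval (b j)).domRestrict (degreeLT F k)

@[simp]
theorem coeffEvalDegreeLT_none {F κ : Type*} [Field F] (k : ℕ) (b : κ → F) (f : degreeLT F k) :
    coeffEvalDegreeLT k b f none = (f : F[X]).coeff (k - 1) := rfl

@[simp]
theorem coeffEvalDegreeLT_some {F κ : Type*} [Field F] (k : ℕ) (b : κ → F) (f : degreeLT F k)
    (j : κ) : coeffEvalDegreeLT k b f (some j) = (f : F[X]).eval (b j) := rfl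

theorem coeffEvalDegreeLT_surjective {F κ : Type*} [Field F] [Fintype κ] {k : ℕ} {b : κ → F}
    (hb : Function.Injective b) (hk : Fintype.card κ < k) :
    Function.Surjective (coeffEvalDegreeLT k b) := by
  intro y
  -- Fix the leading coefficient with a monomial, then correct the values in lower degree.
  obtain ⟨f, hf, hfy⟩ := exists_degreeLT_eval_eq hb
    fun j => y (some j) - y none * b j ^ (k - 1)
  have hf' : f.degree < (k - 1 : ℕ) :=
    mem_degreeLT.1 (degreeLT_mono (show Fintype.card κ ≤ k - 1 by omega) hf)
  have hX : C (y none) * X ^ (k - 1) ∈ degreeLT F k := by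
    rw [mem_degreeLT]
    exact (degree_C_mul_X_pow_le _ _).trans_lt (by exact_mod_cast (by omega : k - 1 < k))
  refine ⟨⟨f + C (y none) * X ^ (k - 1),
    Submodule.add_mem _ (degreeLT_mono hk.le hf) hX⟩, funext fun j => ?_⟩
  cases j with
  | none => simp [coeff_eq_zero_of_degree_lt hf']
  | some j => simp [hfy]

theorem grsCode_eq_range {F ι : Type*} [Field F] (k : ℕ) (a v : ι → F) :
    grsCode k a v = LinearMap.range ((grsEval a v).domRestrict (degreeLT F k)) :=
  (LinearMap.range_domRestrict _ _).symm

theorem extGrsCode_eq_range {F : Type*} [Field F] {m : ℕ} (k : ℕ) (a v : Fin m → F) :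
    extGrsCode k a v = LinearMap.range ((extGrsEval k a v).domRestrict (degreeLT F k)) :=
  (LinearMap.range_domRestrict _ _).symm

theorem isMDSCode_grsCode {F : Type*} [Field F] [DecidableEq F] {N k : ℕ} (hk : 1 ≤ k)
    (hkN : k ≤ N) {a v : Fin N → F} (ha : Function.Injective a) (hv : ∀ i, v i ≠ 0) :
    IsMDSCode N k (grsCode k a v) := by
  rw [grsCode_eq_range]
  exact isMDSCode_range hk hkN _ (finrank_degreeLT F k) fun f hf =>
    card_zeros_grsEval_lt ha hv f.2 (by simpa using hf)

theorem isMDSCode_extGrsCode {F : Type*} [Field F] [DecidableEq F] {m k : ℕ} (hk : 1 ≤ k)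
    (hkm : k ≤ m + 1) {a v : Fin m → F} (ha : Function.Injective a) (hv : ∀ i, v i ≠ 0) :
    IsMDSCode (m + 1) k (extGrsCode k a v) := by
  rw [extGrsCode_eq_range]
  exact isMDSCode_range hk hkm _ (finrank_degreeLT F k) fun f hf =>
    card_zeros_extGrsEval_lt ha hv f.2 (by simpa using hf)

/-- A Reed-Solomon code whose Galois form is diagonal, with nonzero coefficients, in the values at
`κ` distinct points (which need not be evaluation points of the code) has a hull of codimension
`κ`. -/
theorem finrank_galoisHull_grsCode {F κ : Type*} [Field F] [DecidableEq F] [Fintype κ]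
    (p l : ℕ) [Fact p.Prime] [CharP F p] {N k : ℕ} (hkN : k ≤ N) {a v : Fin N → F}
    (ha : Function.Injective a) (hv : ∀ i, v i ≠ 0) {b : κ → F} (hb : Function.Injective b)
    (hκ : Fintype.card κ ≤ k) (c : κ → F) (hc : ∀ j, c j ≠ 0)
    (hform : ∀ f ∈ degreeLT F k, ∀ g ∈ degreeLT F k,
      galoisForm p l (grsEval a v f) (grsEval a v g)
        = ∑ j, c j * f.eval (b j) * g.eval (b j) ^ p ^ l) :
    Module.finrank F (galoisHull p l (grsCode k a v)) + Fintype.card κ = k := by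
  rw [grsCode_eq_range]
  refine (finrank_galoisHull_range_add_card p l _ ?_ (evalDegreeLT k b)
    (evalDegreeLT_surjective hb hκ) c hc fun f g => hform f f.2 g g.2).trans
    (finrank_degreeLT F k)
  exact injective_of_card_zeros_lt hkN _ fun f hf =>
    card_zeros_grsEval_lt ha hv f.2 (by simpa using hf)

theorem finrank_galoisHull_extGrsCode {F κ : Type*} [Field F] [DecidableEq F] [Fintype κ]
    (p l : ℕ) [Fact p.Prime] [CharP F p] {m k : ℕ} (hkm : k ≤ m + 1) {a v : Fin m → F}
    (ha : Function.Injective a) (hv : ∀ i, v i ≠ 0) {b : κ → F} (hb : Function.Injective b)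
    (hκ : Fintype.card κ < k) (c : κ → F) (hc : ∀ j, c j ≠ 0)
    (hform : ∀ f ∈ degreeLT F k, ∀ g ∈ degreeLT F k,
      galoisForm p l (extGrsEval k a v f) (extGrsEval k a v g)
        = f.coeff (k - 1) * g.coeff (k - 1) ^ p ^ l
          + ∑ j, c j * f.eval (b j) * g.eval (b j) ^ p ^ l) :
    Module.finrank F (galoisHull p l (extGrsCode k a v)) + (Fintype.card κ + 1) = k := by
  rw [extGrsCode_eq_range, ← Fintype.card_option]
  refine (finrank_galoisHull_range_add_card p l _ ?_ (coeffEvalDegreeLT k b)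
    (coeffEvalDegreeLT_surjective hb hκ) (fun j => j.elim 1 c) ?_ fun f g => ?_).trans
    (finrank_degreeLT F k)
  · exact injective_of_card_zeros_lt hkm _ fun f hf =>
      card_zeros_extGrsEval_lt ha hv f.2 (by simpa using hf)
  · rintro (_ | j)
    · exact one_ne_zero
    · exact hc j
  · refine (hform f f.2 g g.2).trans ?_
    simp [Fintype.sum_option]

/-! ### Adjusting the hull by rescaling coordinates -/

/-- The column multipliers `w`, rescaled by `β` on the coordinates in `S`. -/
def rescale {F ι : Type*} [Field F] [DecidableEq ι] (w : ι → F) (β : F) (S : Finset ι) : ι → F :=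
  fun i => if i ∈ S then β * w i else w i

theorem rescale_ne_zero {F ι : Type*} [Field F] [DecidableEq ι] {w : ι → F} (hw : ∀ i, w i ≠ 0)
    {β : F} (hβ : β ≠ 0) (S : Finset ι) (i : ι) : rescale w β S i ≠ 0 := by
  unfold rescale
  split_ifs
  · exact mul_ne_zero hβ (hw i)
  · exact hw i

theorem mul_pow_mem_degreeLT {F : Type*} [Field F] {k s n : ℕ} (hk : 1 ≤ k)
    (hkn : (k - 1) * (s + 1) < n) {f g : F[X]} (hf : f ∈ degreeLT F k) (hg : g ∈ degreeLT F k) :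
    f * g ^ s ∈ degreeLT F n := by
  have key : ∀ f : F[X], f ∈ degreeLT F k → f.natDegree ≤ k - 1 := by
    intro f hf
    rcases eq_or_ne f 0 with rfl | h0
    · simp
    · have := (natDegree_lt_iff_degree_lt h0).2 (mem_degreeLT.1 hf)
      omega
  rw [mem_degreeLT]
  refine degree_le_natDegree.trans_lt (Nat.cast_lt.2 ?_)
  calc (f * g ^ s).natDegree ≤ f.natDegree + s * g.natDegree :=
        natDegree_mul_le.trans (Nat.add_le_add_left natDegree_pow_le _)
    _ ≤ (k - 1) + s * (k - 1) :=
        Nat.add_le_add (key f hf) (Nat.mul_le_mul_left _ (key g hg))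
    _ = (k - 1) * (s + 1) := by ring
    _ < n := hkn

section Hull

variable {F : Type*} [Field F] {p l n k : ℕ} {a w : Fin (n + 1) → F} {β : F}

/-- If the weights `w i ^ (p ^ l + 1)` annihilate all polynomials of degree less than `n`, then
only the rescaled coordinates contribute to the Galois form. -/
theorem galoisForm_grsEval_rescale (hk : 1 ≤ k) (hkn : (k - 1) * (p ^ l + 1) < n)
    (hsum : ∀ P ∈ degreeLT F n, ∑ i, w i ^ (p ^ l + 1) * P.eval (a i) = 0)
    (S : Finset (Fin (n + 1))) {f g : F[X]} (hf : f ∈ degreeLT F k) (hg : g ∈ degreeLT F k) :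
    galoisForm p l (grsEval a (rescale w β S) f) (grsEval a (rescale w β S) g)
      = ∑ j : S, (β ^ (p ^ l + 1) - 1) * w j ^ (p ^ l + 1) * f.eval (a j)
          * g.eval (a j) ^ p ^ l := by
  have h0 := hsum _ (mul_pow_mem_degreeLT hk hkn hf hg)
  have hS : ∑ j : S, (β ^ (p ^ l + 1) - 1) * w j ^ (p ^ l + 1) * f.eval (a j)
        * g.eval (a j) ^ p ^ l
      = ∑ i, if i ∈ S then (β ^ (p ^ l + 1) - 1) * w i ^ (p ^ l + 1) * f.eval (a i)
        * g.eval (a i) ^ p ^ l else 0 := by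
    rw [Finset.sum_ite_mem, Finset.univ_inter]
    exact Finset.sum_coe_sort S fun j => (β ^ (p ^ l + 1) - 1) * w j ^ (p ^ l + 1) * f.eval (a j)
      * g.eval (a j) ^ p ^ l
  rw [hS, ← sub_eq_zero, galoisForm, ← Finset.sum_sub_distrib]
  refine Eq.trans ?_ h0
  refine Finset.sum_congr rfl fun i _ => ?_
  simp only [grsEval, LinearMap.coe_mk, AddHom.coe_mk, rescale, eval_mul, eval_pow]
  split_ifs <;> ring

theorem coeff_rescale_ne_zero {F ι : Type*} [Field F] {w : ι → F} (hw : ∀ i, w i ≠ 0) {β : F}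
    {s : ℕ} (hβ : β ^ s ≠ 1) (i : ι) : (β ^ s - 1) * w i ^ s ≠ 0 :=
  mul_ne_zero (sub_ne_zero.2 hβ) (pow_ne_zero _ (hw i))

variable [Fact p.Prime] [CharP F p]

/-- On all `n + 1` points the code with multipliers `w` is its own hull; rescaling `k - h`
coordinates lowers the hull dimension to `h`. -/
theorem exists_finrank_galoisHull_grsCode [DecidableEq F]
    (ha : Function.Injective a) (hw : ∀ i, w i ≠ 0)
    (hsum : ∀ P ∈ degreeLT F n, ∑ i, w i ^ (p ^ l + 1) * P.eval (a i) = 0)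
    (hβ₀ : β ≠ 0) (hβ : β ^ (p ^ l + 1) ≠ 1) (hk : 1 ≤ k)
    (hkn : (k - 1) * (p ^ l + 1) < n) {h : ℕ} (hh : h ≤ k) :
    ∃ v : Fin (n + 1) → F, (∀ i, v i ≠ 0) ∧
      Module.finrank F (galoisHull p l (grsCode k a v)) = h := by
  have hkn' : k - 1 < n :=
    (Nat.le_mul_of_pos_right (k - 1) (Nat.succ_pos (p ^ l))).trans_lt hkn
  obtain ⟨S, -, hS⟩ := Finset.exists_subset_card_eq
    (show k - h ≤ (Finset.univ : Finset (Fin (n + 1))).card by simp; omega)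
  have hv := rescale_ne_zero hw hβ₀ S
  refine ⟨_, hv, ?_⟩
  have := finrank_galoisHull_grsCode p l (by omega) ha hv
    (b := fun j : S => a j) (ha.comp Subtype.val_injective)
    (by rw [Fintype.card_coe, hS]; omega) (fun j : S => (β ^ (p ^ l + 1) - 1) * w j ^ (p ^ l + 1))
    (fun j => coeff_rescale_ne_zero hw hβ j)
    fun f hf g hg => galoisForm_grsEval_rescale hk hkn hsum S hf hg
  rw [Fintype.card_coe, hS] at this
  omega

/-- Dropping the point `a 0` adds the value at `a 0` to the functionals that cut out the hull, which
therefore has dimension at most `k - 1`. -/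
theorem exists_finrank_galoisHull_grsCode_succ [DecidableEq F]
    (ha : Function.Injective a) (hw : ∀ i, w i ≠ 0)
    (hsum : ∀ P ∈ degreeLT F n, ∑ i, w i ^ (p ^ l + 1) * P.eval (a i) = 0)
    (hβ₀ : β ≠ 0) (hβ : β ^ (p ^ l + 1) ≠ 1) (hk : 1 ≤ k)
    (hkn : (k - 1) * (p ^ l + 1) < n) {h : ℕ} (hh : h ≤ k - 1) :
    ∃ v : Fin n → F, (∀ i, v i ≠ 0) ∧
      Module.finrank F (galoisHull p l (grsCode k (fun i => a i.succ) v)) = h := by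
  have hkn' : k - 1 < n :=
    (Nat.le_mul_of_pos_right (k - 1) (Nat.succ_pos (p ^ l))).trans_lt hkn
  obtain ⟨S, hS0, hS⟩ := Finset.exists_subset_card_eq
    (show k - 1 - h ≤ ((Finset.univ : Finset (Fin (n + 1))).erase 0).card by simp; omega)
  have h0S : (0 : Fin (n + 1)) ∉ S := fun h => by simpa using hS0 h
  have hv := rescale_ne_zero hw hβ₀ S
  refine ⟨fun i => rescale w β S i.succ, fun i => hv _, ?_⟩
  have hb : Function.Injective (fun j : Option S => a (j.elim 0 (↑))) := by
    refine ha.comp ?_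
    rintro (_ | ⟨i, hi⟩) (_ | ⟨j, hj⟩) hij
    · rfl
    · exact absurd (show (0 : Fin (n + 1)) = j from hij) (fun h => h0S (h ▸ hj))
    · exact absurd (show i = (0 : Fin (n + 1)) from hij) (fun h => h0S (h ▸ hi))
    · exact congrArg some (Subtype.ext hij)
  have := finrank_galoisHull_grsCode p l (k := k) (a := fun i => a i.succ)
    (v := fun i => rescale w β S i.succ) (by omega)
    (ha.comp (Fin.succ_injective n)) (fun i => hv i.succ) hb
    (by rw [Fintype.card_option, Fintype.card_coe, hS]; omega)
    (fun j : Option S => j.elim (-w 0 ^ (p ^ l + 1))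
      fun j => (β ^ (p ^ l + 1) - 1) * w j ^ (p ^ l + 1)) ?_ ?_
  · rw [Fintype.card_option, Fintype.card_coe, hS] at this
    omega
  · rintro (_ | j)
    · exact neg_ne_zero.2 (pow_ne_zero _ (hw 0))
    · exact coeff_rescale_ne_zero hw hβ _
  · intro f hf g hg
    have h1 := galoisForm_grsEval_rescale (β := β) hk hkn hsum S hf hg
    rw [galoisForm, Fin.sum_univ_succ] at h1
    simp only [grsEval, LinearMap.coe_mk, AddHom.coe_mk, rescale, h0S, if_false] at h1
    simp only [Fintype.sum_option, Option.elim_none, Option.elim_some]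
    rw [← h1]
    simp only [galoisForm, grsEval, LinearMap.coe_mk, AddHom.coe_mk, rescale]
    ring

/-- The point at infinity adds the top coefficient to the functionals that cut out the hull. -/
theorem exists_finrank_galoisHull_extGrsCode [DecidableEq F]
    (ha : Function.Injective a) (hw : ∀ i, w i ≠ 0)
    (hsum : ∀ P ∈ degreeLT F n, ∑ i, w i ^ (p ^ l + 1) * P.eval (a i) = 0)
    (hβ₀ : β ≠ 0) (hβ : β ^ (p ^ l + 1) ≠ 1) (hk : 1 ≤ k)
    (hkn : (k - 1) * (p ^ l + 1) < n) {h : ℕ} (hh : h ≤ k - 1) :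
    ∃ v : Fin (n + 1) → F, (∀ i, v i ≠ 0) ∧
      Module.finrank F (galoisHull p l (extGrsCode k a v)) = h := by
  have hkn' : k - 1 < n :=
    (Nat.le_mul_of_pos_right (k - 1) (Nat.succ_pos (p ^ l))).trans_lt hkn
  obtain ⟨S, -, hS⟩ := Finset.exists_subset_card_eq
    (show k - 1 - h ≤ (Finset.univ : Finset (Fin (n + 1))).card by simp; omega)
  have hv := rescale_ne_zero hw hβ₀ S
  refine ⟨_, hv, ?_⟩
  have := finrank_galoisHull_extGrsCode p l (k := k) (by omega) ha hv
    (b := fun j : S => a j) (ha.comp Subtype.val_injective)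
    (by rw [Fintype.card_coe, hS]; omega) (fun j : S => (β ^ (p ^ l + 1) - 1) * w j ^ (p ^ l + 1))
    (fun j => coeff_rescale_ne_zero hw hβ j) fun f hf g hg => ?_
  · rw [Fintype.card_coe, hS] at this
    omega
  · rw [← galoisForm_grsEval_rescale hk hkn hsum S hf hg, galoisForm, Fin.sum_univ_castSucc,
      add_comm]
    simp [extGrsEval, grsEval, galoisForm]

end Hull

/-! ### Barycentric weights and the Frobenius -/

theorem sum_nodalWeight_mul_eval_eq_zero {F : Type*} [Field F] {n : ℕ} {a : Fin (n + 1) → F}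
    (ha : Function.Injective a) {P : F[X]} (hP : P ∈ degreeLT F n) :
    ∑ i, Lagrange.nodalWeight Finset.univ a i * P.eval (a i) = 0 := by
  rw [mem_degreeLT] at hP
  have h := Lagrange.coeff_eq_sum (s := Finset.univ) (ha.injOn) (P := P)
    (hP.trans (by simp; exact_mod_cast Nat.lt_succ_self n))
  rw [Finset.card_univ, Fintype.card_fin, Nat.add_sub_cancel, coeff_eq_zero_of_degree_lt hP] at h
  rw [h]
  refine Finset.sum_congr rfl fun i _ => ?_
  rw [Lagrange.nodalWeight, Finset.prod_inv_distrib, div_eq_mul_inv, mul_comm]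

/-- The derivative of `X * G (X ^ m)` is `G (X ^ m) + m * X ^ m * G' (X ^ m)`, so its value at `a i`
depends on `a i ^ m` only, and is fixed by `φ` when `a i ^ m` and the coefficients of `G` are. -/
theorem map_nodalWeight_eq {F ι : Type*} [Field F] [Fintype ι] [DecidableEq ι] (φ : F →+* F)
    {G : F[X]} (hG : G.map φ = G) {m : ℕ} (hm : m ≠ 0) {a : ι → F}
    (hnodal : Lagrange.nodal Finset.univ a = X * G.comp (X ^ m)) {i : ι}
    (hi : φ (a i ^ m) = a i ^ m) :
    φ (Lagrange.nodalWeight Finset.univ a i) = Lagrange.nodalWeight Finset.univ a i := by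
  have key : ∀ H : F[X], H.map φ = H → φ (H.eval (a i ^ m)) = H.eval (a i ^ m) := by
    intro H hH
    conv_rhs => rw [← hH, ← hi, eval_map_apply]
  have hG' : (derivative G).map φ = derivative G := by rw [← derivative_map, hG]
  have hval : (derivative (Lagrange.nodal Finset.univ a)).eval (a i)
      = G.eval (a i ^ m) + m * a i ^ m * (derivative G).eval (a i ^ m) := by
    rw [hnodal]
    obtain ⟨m, rfl⟩ := Nat.exists_eq_succ_of_ne_zero hm
    simp [derivative_comp, eval_comp]
    ring
  rw [Lagrange.nodalWeight_eq_eval_derivative_nodal (Finset.mem_univ i), map_inv₀, hval, map_add,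
    map_mul, map_mul, map_natCast, hi, key G hG, key _ hG']

/-! ### The evaluation points -/

theorem ne_zero_of_mem_evalPoints {F : Type*} [Field F] {ξ₁ ξ₂ : Fˣ} {r : ℕ} {b : F}
    (hb : b ∈ evalPoints ξ₁ ξ₂ r) : b ≠ 0 := by
  obtain ⟨i, j, -, -, -, -, rfl⟩ := hb
  exact mul_ne_zero (pow_ne_zero _ ξ₁.ne_zero) (pow_ne_zero _ ξ₂.ne_zero)

theorem pow_mul_pow_injOn {G : Type*} [CommGroup G] {ξ₁ ξ₂ : G} {r : ℕ}
    (hdisj : Disjoint (Subgroup.zpowers ξ₁) (Subgroup.zpowers ξ₂)) (hr : r ≤ orderOf ξ₁) :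
    Set.InjOn (fun x : ℕ × ℕ => ξ₁ ^ x.1 * ξ₂ ^ x.2)
      (Finset.Icc 1 r ×ˢ Finset.Icc 1 (orderOf ξ₂) : Finset (ℕ × ℕ)) := by
  have key : ∀ (ξ : G) (i j : ℕ), i ∈ Finset.Icc 1 (orderOf ξ) → j ∈ Finset.Icc 1 (orderOf ξ) →
      ξ ^ i = ξ ^ j → i = j := by
    intro ξ i j hi hj h
    rw [Finset.mem_Icc] at hi hj
    -- Shift to exponents below the order.
    have h' : ξ ^ (i - 1) = ξ ^ (j - 1) := by
      apply mul_right_cancel (b := ξ)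
      rwa [← pow_succ, ← pow_succ, Nat.sub_add_cancel hi.1, Nat.sub_add_cancel hj.1]
    have := pow_injOn_Iio_orderOf (show i - 1 ∈ Set.Iio (orderOf ξ) by simp; omega)
      (show j - 1 ∈ Set.Iio (orderOf ξ) by simp; omega) h'
    omega
  rintro ⟨i, j⟩ hij ⟨i', j'⟩ hij' h
  rw [Finset.mem_coe, Finset.mem_product] at hij hij'
  have hir := Finset.mem_Icc.1 hij.1
  have hir' := Finset.mem_Icc.1 hij'.1
  have h1 : (ξ₁ ^ i')⁻¹ * ξ₁ ^ i = ξ₂ ^ j' * (ξ₂ ^ j)⁻¹ := by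
    rw [inv_mul_eq_iff_eq_mul, ← mul_assoc, eq_mul_inv_iff_mul_eq]
    exact h
  have hmem : ∀ (ξ : G) (i : ℕ), ξ ^ i ∈ Subgroup.zpowers ξ := fun ξ i =>
    Subgroup.pow_mem _ (Subgroup.mem_zpowers ξ) i
  have h2 : (ξ₁ ^ i')⁻¹ * ξ₁ ^ i = 1 := by
    refine Subgroup.disjoint_def.1 hdisj (mul_mem (inv_mem (hmem _ _)) (hmem _ _)) ?_
    rw [h1]
    exact mul_mem (hmem _ _) (inv_mem (hmem _ _))
  have h3 : ξ₂ ^ j' * (ξ₂ ^ j)⁻¹ = 1 := h1 ▸ h2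
  exact Prod.ext
    (key ξ₁ i i' (Finset.mem_Icc.2 ⟨hir.1, hir.2.trans hr⟩)
      (Finset.mem_Icc.2 ⟨hir'.1, hir'.2.trans hr⟩) (inv_mul_eq_one.1 h2).symm)
    (key ξ₂ j j' hij.2 hij'.2 (mul_inv_eq_one.1 h3).symm)

theorem exists_enumeration_evalPoints {F : Type*} [Field F] {ξ₁ ξ₂ : Fˣ} {r : ℕ}
    (hdisj : Disjoint (Subgroup.zpowers ξ₁) (Subgroup.zpowers ξ₂)) (hr : r ≤ orderOf ξ₁) :
    ∃ a : Fin (r * orderOf ξ₂) → F, Function.Injective a ∧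
      Set.range a = evalPoints ξ₁ ξ₂ r := by
  classical
  let R : Finset F := (Finset.Icc 1 r ×ˢ Finset.Icc 1 (orderOf ξ₂)).image
    fun x => ((ξ₁ ^ x.1 * ξ₂ ^ x.2 : Fˣ) : F)
  have hcard : R.card = r * orderOf ξ₂ := by
    refine (Finset.card_image_of_injOn
      (Units.val_injective.comp_injOn (pow_mul_pow_injOn hdisj hr))).trans ?_
    simp
  refine ⟨fun i => (R.equivFinOfCardEq hcard).symm i,
    Subtype.val_injective.comp (Equiv.injective _), ?_⟩
  have hrange : Set.range (fun i => (((R.equivFinOfCardEq hcard).symm i : R) : F)) = R :=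
    ((R.equivFinOfCardEq hcard).symm.surjective.range_comp (fun x : R => (x : F))).trans
      Subtype.range_coe
  rw [hrange]
  ext b
  simp only [R, Finset.coe_image, Set.mem_image, Finset.mem_coe, Finset.mem_product,
    Finset.mem_Icc, Prod.exists, evalPoints, Set.mem_ofPred_eq]
  constructor
  · rintro ⟨i, j, ⟨⟨h1, h2⟩, h3, h4⟩, rfl⟩
    exact ⟨i, j, h1, h2, h3, h4, by push_cast; rfl⟩
  · rintro ⟨i, j, h1, h2, h3, h4, rfl⟩
    exact ⟨i, j, ⟨⟨h1, h2⟩, h3, h4⟩, by push_cast; rfl⟩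

/-- The points are a union of `r` cosets of the group generated by `ξ₂`, whose nodal polynomials
are binomials. -/
theorem nodal_evalPoints {F : Type*} [Field F] {ξ₁ ξ₂ : Fˣ} {r : ℕ} (hξ₂ : 0 < orderOf ξ₂)
    {a : Fin (r * orderOf ξ₂) → F} (ha : Function.Injective a)
    (hrange : Set.range a = evalPoints ξ₁ ξ₂ r) :
    Lagrange.nodal Finset.univ a
      = ∏ s ∈ Finset.Icc 1 r, (X ^ orderOf ξ₂ - C (((ξ₁ : F) ^ s) ^ orderOf ξ₂)) := by
  have hm : (∏ s ∈ Finset.Icc 1 r,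
      (X ^ orderOf ξ₂ - C (((ξ₁ : F) ^ s) ^ orderOf ξ₂))).Monic :=
    monic_prod_of_monic _ _ fun s _ => monic_X_pow_sub_C _ hξ₂.ne'
  have hdeg : (∏ s ∈ Finset.Icc 1 r,
      (X ^ orderOf ξ₂ - C (((ξ₁ : F) ^ s) ^ orderOf ξ₂))).natDegree = r * orderOf ξ₂ := by
    rw [natDegree_prod_of_monic _ _ fun s _ => monic_X_pow_sub_C _ hξ₂.ne']
    simp only [natDegree_X_pow_sub_C, Finset.sum_const, Nat.card_Icc, Nat.add_sub_cancel,
      smul_eq_mul]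
  have hn : (Lagrange.nodal Finset.univ a).degree = (r * orderOf ξ₂ : ℕ) := by
    simp [Lagrange.degree_nodal]
  refine Polynomial.eq_of_degree_sub_lt_of_eval_index_eq Finset.univ ha.injOn ?_ fun i _ => ?_
  · rw [Finset.card_univ, Fintype.card_fin, ← hn]
    refine degree_sub_lt_left ?_ Lagrange.nodal_ne_zero ?_
    · rw [hn, degree_eq_natDegree hm.ne_zero, hdeg]
    · rw [hm.leadingCoeff, Lagrange.nodal_monic.leadingCoeff]
  · rw [Lagrange.eval_nodal_at_node (Finset.mem_univ i), eval_prod]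
    obtain ⟨s, j, hs, hsr, -, -, hi⟩ : a i ∈ evalPoints ξ₁ ξ₂ r := hrange ▸ ⟨i, rfl⟩
    refine (Finset.prod_eq_zero (Finset.mem_Icc.2 ⟨hs, hsr⟩) ?_).symm
    have h : (ξ₂ : F) ^ orderOf ξ₂ = 1 := by
      rw [← Units.val_pow_eq_pow_val, pow_orderOf_eq_one, Units.val_one]
    simp [hi, mul_pow, ← pow_mul (ξ₂ : F), mul_comm j, pow_mul (ξ₂ : F) (orderOf ξ₂), h]

/-- All barycentric weights of the points together with `0` lie in the fixed field of `φ`. -/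
theorem map_nodalWeight_cons_evalPoints {F : Type*} [Field F] (φ : F →+* F) {ξ₁ ξ₂ : Fˣ} {r : ℕ}
    (hφ : φ ξ₁ = ξ₁) (hξ₂ : 0 < orderOf ξ₂) {a : Fin (r * orderOf ξ₂) → F}
    (ha : Function.Injective a) (hrange : Set.range a = evalPoints ξ₁ ξ₂ r)
    (i : Fin (r * orderOf ξ₂ + 1)) :
    φ (Lagrange.nodalWeight Finset.univ (Fin.cons 0 a : Fin (r * orderOf ξ₂ + 1) → F) i)
      = Lagrange.nodalWeight Finset.univ (Fin.cons 0 a : Fin (r * orderOf ξ₂ + 1) → F) i := by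
  refine map_nodalWeight_eq φ
    (G := ∏ s ∈ Finset.Icc 1 r, (X - C (((ξ₁ : F) ^ s) ^ orderOf ξ₂))) ?_ hξ₂.ne' ?_ ?_
  · simp [Polynomial.map_prod, hφ]
  · have h := nodal_evalPoints hξ₂ ha hrange
    rw [Lagrange.nodal] at h ⊢
    simp only [Fin.prod_univ_succ, Fin.cons_zero, Fin.cons_succ, h, map_zero, sub_zero, prod_comp,
      sub_comp, X_comp, C_comp]
  · refine Fin.cases ?_ (fun i => ?_) i
    · simp
    · obtain ⟨s, j, -, -, -, -, hi⟩ : a i ∈ evalPoints ξ₁ ξ₂ r := hrange ▸ ⟨i, rfl⟩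
      have h : (ξ₂ : F) ^ orderOf ξ₂ = 1 := by
        rw [← Units.val_pow_eq_pow_val, pow_orderOf_eq_one, Units.val_one]
      have h' : ((ξ₂ : F) ^ j) ^ orderOf ξ₂ = 1 := by rw [pow_right_comm, h, one_pow]
      rw [Fin.cons_succ, hi, mul_pow, h', mul_one, map_pow, map_pow, hφ]

/-! ### Cyclic groups -/

theorem dvd_lcm_gcd_of_dvd_lcm {N x y : ℕ} (hN : 0 < N) (h : N ∣ Nat.lcm x y) :
    N ∣ Nat.lcm x (Nat.gcd y N) := by
  have hg : 0 < Nat.gcd x (Nat.gcd y N) :=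
    Nat.gcd_pos_of_pos_right _ (Nat.gcd_pos_of_pos_right _ hN)
  refine Nat.dvd_of_mul_dvd_mul_left hg ?_
  rw [Nat.gcd_mul_lcm, ← Nat.gcd_mul_left]
  refine Nat.dvd_gcd ?_ (Nat.mul_dvd_mul_right (Nat.gcd_dvd_left _ _) _)
  calc Nat.gcd x (Nat.gcd y N) * N ∣ Nat.gcd x y * Nat.lcm x y :=
        mul_dvd_mul (Nat.gcd_dvd_gcd_of_dvd_right _ (Nat.gcd_dvd_left _ _)) h
    _ = x * y := Nat.gcd_mul_lcm _ _

/-- The subgroups have indices `gcd x N` and `gcd y N`, where `N` is the order of `α`, and their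
intersection has index `gcd (lcm x y) N = N`. -/
theorem disjoint_zpowers_pow {G : Type*} [Group G] {α : G} (hα : 0 < orderOf α) {x y : ℕ}
    (h : orderOf α ∣ Nat.lcm x y) :
    Disjoint (Subgroup.zpowers (α ^ x)) (Subgroup.zpowers (α ^ y)) := by
  have hfin : IsOfFinOrder α := orderOf_pos_iff.1 hα
  rw [Subgroup.disjoint_def]
  intro z hx hy
  rw [← hfin.pow.mem_powers_iff_mem_zpowers] at hx hy
  obtain ⟨s, rfl⟩ := hx
  obtain ⟨t, ht⟩ := hy
  simp only [← pow_mul] at ht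
  have hmod : y * t ≡ x * s [MOD orderOf α] := pow_eq_pow_iff_modEq.1 ht
  have hdvd : Nat.gcd y (orderOf α) ∣ x * s :=
    (hmod.dvd_iff (Nat.gcd_dvd_right _ _)).1 ((Nat.gcd_dvd_left _ _).mul_right _)
  beta_reduce
  rw [← pow_mul, ← orderOf_dvd_iff_pow_eq_one]
  exact (dvd_lcm_gcd_of_dvd_lcm hα h).trans (Nat.lcm_dvd (dvd_mul_right _ _) hdvd)

theorem exists_pow_eq_of_pow_eq_one {G : Type*} [Group G] {α : G} (hα : 0 < orderOf α)
    (hgen : ∀ x : G, x ∈ Subgroup.zpowers α) {d t : ℕ} (hdt : d * t ∣ orderOf α) {u : G}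
    (hu : u ^ d = 1) : ∃ w : G, w ^ t = u := by
  have hd : 0 < d := Nat.pos_of_mul_pos_right (Nat.pos_of_dvd_of_pos hdt hα)
  have hu' := hgen u
  rw [← (orderOf_pos_iff.1 hα).mem_powers_iff_mem_zpowers] at hu'
  obtain ⟨j, rfl⟩ := hu'
  rw [← pow_mul, ← orderOf_dvd_iff_pow_eq_one, mul_comm] at hu
  obtain ⟨c, rfl⟩ := Nat.dvd_of_mul_dvd_mul_left hd (hdt.trans hu)
  exact ⟨α ^ c, by rw [← pow_mul, mul_comm]⟩

theorem pow_sub_one_mul_pow_add_one_dvd {p l e : ℕ} (hl : 2 * l ∣ e) :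
    (p ^ l - 1) * (p ^ l + 1) ∣ p ^ e - 1 := by
  obtain ⟨c, rfl⟩ := hl
  have h := Nat.sub_dvd_pow_sub_pow (p ^ (2 * l)) 1 c
  rw [one_pow, ← pow_mul] at h
  rwa [mul_comm, ← Nat.sq_sub_sq, one_pow, ← pow_mul, mul_comm l 2]

end

/-! ### The three families of codes -/

theorem theorem3 {F : Type*} [Field F] [Fintype F] [DecidableEq F]
    (p e q l : ℕ) [Fact p.Prime] [CharP F p]
    (hp : Odd p) (hq : q = p ^ e) (hF : Fintype.card F = q) (hl : 2 * l ∣ e)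
    (x₁ x₂ : ℕ) (hx : (q - 1) ∣ Nat.lcm x₁ x₂) (hx₁ : (q - 1) / (p ^ l - 1) ∣ x₁)
    (r n : ℕ) (hr : 1 ≤ r) (hr' : r ≤ (q - 1) / Nat.gcd x₁ (q - 1))
    (hn : n = r * (q - 1) / Nat.gcd x₂ (q - 1))
    (α : Fˣ) (hα : ∀ x : Fˣ, x ∈ Subgroup.zpowers α)
    (k : ℕ) (hk : 1 ≤ k) (hk' : k ≤ (p ^ l + n) / (p ^ l + 1)) :
    (∀ h : ℕ, h ≤ k - 1 → ∃ a v : Fin n → F,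
      Function.Injective a ∧ Set.range a = evalPoints (α ^ x₁) (α ^ x₂) r ∧ (∀ i, v i ≠ 0) ∧
      IsMDSCode n k (grsCode k a v) ∧
      Module.finrank F (galoisHull p l (grsCode k a v)) = h) ∧
    (∀ h : ℕ, h ≤ k → ∃ a v : Fin (n + 1) → F,
      Function.Injective a ∧ Set.range a = insert 0 (evalPoints (α ^ x₁) (α ^ x₂) r) ∧
      (∀ i, v i ≠ 0) ∧
      IsMDSCode (n + 1) k (grsCode k a v) ∧
      Module.finrank F (galoisHull p l (grsCode k a v)) = h) ∧
    (∀ h : ℕ, h ≤ k - 1 → ∃ a v : Fin (n + 1) → F,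
      Function.Injective a ∧ Set.range a = insert 0 (evalPoints (α ^ x₁) (α ^ x₂) r) ∧
      (∀ i, v i ≠ 0) ∧
      IsMDSCode (n + 2) k (extGrsCode k a v) ∧
      Module.finrank F (galoisHull p l (extGrsCode k a v)) = h) := by

  have hcard : 1 < p ^ e := hq ▸ hF ▸ Fintype.one_lt_card
  have he : e ≠ 0 := by rintro rfl; simp at hcard
  have hl0 : l ≠ 0 := by rintro rfl; exact he (by simpa using hl)
  have hp3 : 3 ≤ p := by
    have := (Fact.out : p.Prime).two_le
    have : p ≠ 2 := by rintro rfl; exact absurd hp (by decide)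
    omega
  have hpl : 3 ≤ p ^ l := hp3.trans (Nat.le_self_pow hl0 p)
  have hord : orderOf α = q - 1 := by
    rw [orderOf_eq_card_of_forall_mem_zpowers hα, Nat.card_eq_fintype_card, Fintype.card_units, hF]
  have hord0 : 0 < orderOf α := orderOf_pos α
  have hdvd : (p ^ l - 1) * (p ^ l + 1) ∣ orderOf α := by
    rw [hord, hq]
    exact pow_sub_one_mul_pow_add_one_dvd hl
  have hr₁ : r ≤ orderOf (α ^ x₁) := by rwa [orderOf_pow, hord, Nat.gcd_comm]
  obtain rfl : n = r * orderOf (α ^ x₂) := by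
    rw [hn, orderOf_pow, hord, Nat.gcd_comm, Nat.mul_div_assoc _ (Nat.gcd_dvd_left _ _)]
  have hξ₂ : 0 < orderOf (α ^ x₂) := orderOf_pos _
  set n := r * orderOf (α ^ x₂)
  obtain ⟨a, ha, hrange⟩ : ∃ a : Fin n → F, Function.Injective a ∧
      Set.range a = evalPoints (α ^ x₁) (α ^ x₂) r := exists_enumeration_evalPoints
    (disjoint_zpowers_pow hord0 (hord ▸ hx)) hr₁
  have ha' : Function.Injective (Fin.cons 0 a : Fin (n + 1) → F) := by
    rw [Fin.cons_injective_iff, hrange]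
    exact ⟨fun h => ne_zero_of_mem_evalPoints h rfl, ha⟩
  have hrange' : Set.range (Fin.cons 0 a : Fin (n + 1) → F)
      = insert 0 (evalPoints (α ^ x₁) (α ^ x₂) r) := by
    rw [Fin.range_cons, hrange]
  -- `α ^ x₁` lies in the field with `p ^ l` elements, the fixed field of `x ↦ x ^ p ^ l`.
  have hφ : iterateFrobenius F p l ((α ^ x₁ : Fˣ) : F) = ((α ^ x₁ : Fˣ) : F) := by
    have h1 : (α ^ x₁) ^ (p ^ l - 1) = 1 := by
      rw [← pow_mul, ← orderOf_dvd_iff_pow_eq_one, hord]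
      have h2 := Nat.mul_dvd_mul_right hx₁ (p ^ l - 1)
      rwa [Nat.div_mul_cancel (hord ▸ (dvd_mul_right _ _).trans hdvd)] at h2
    rw [iterateFrobenius_def, ← Nat.sub_add_cancel (show 1 ≤ p ^ l by omega), pow_succ,
      ← Units.val_pow_eq_pow_val, h1, Units.val_one, one_mul]
  -- The nonzero elements of that field are `(p ^ l + 1)`-th powers, because
  -- `(p ^ l - 1) * (p ^ l + 1)` divides `q - 1`.
  have hroot : ∀ i : Fin (n + 1), ∃ w : F, w ^ (p ^ l + 1)
      = Lagrange.nodalWeight Finset.univ (Fin.cons 0 a : Fin (n + 1) → F) i := by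
    intro i
    have h0 := Lagrange.nodalWeight_ne_zero (s := Finset.univ) ha'.injOn (Finset.mem_univ i)
    have hfix := map_nodalWeight_cons_evalPoints _ hφ hξ₂ ha hrange i
    rw [iterateFrobenius_def] at hfix
    obtain ⟨w, hw⟩ := exists_pow_eq_of_pow_eq_one hord0 hα hdvd (u := Units.mk0 _ h0) (by
      ext
      rw [Units.val_pow_eq_pow_val, Units.val_mk0, Units.val_one]
      refine mul_right_cancel₀ h0 ?_
      rw [← pow_succ, Nat.sub_add_cancel (by omega), one_mul]
      exact hfix)
    exact ⟨w, by rw [← Units.val_pow_eq_pow_val, hw, Units.val_mk0]⟩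
  choose w hw using hroot
  have hw0 : ∀ i, w i ≠ 0 := by
    intro i hi
    have h0 := Lagrange.nodalWeight_ne_zero (s := Finset.univ) ha'.injOn (Finset.mem_univ i)
    exact h0 (by rw [← hw i, hi, zero_pow (by omega)])
  have hsum : ∀ P ∈ Polynomial.degreeLT F n,
      ∑ i, w i ^ (p ^ l + 1) * P.eval ((Fin.cons 0 a : Fin (n + 1) → F) i) = 0 := by
    intro P hP
    simp only [hw]
    exact sum_nodalWeight_mul_eval_eq_zero ha' hP
  -- `α` serves as the rescaling factor: `q - 1 > p ^ l + 1`, since `p ^ l - 1 ≥ 2`.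
  have hβ : (α : F) ^ (p ^ l + 1) ≠ 1 := by
    intro h
    have h1 : orderOf α ∣ p ^ l + 1 :=
      orderOf_dvd_of_pow_eq_one (Units.ext (by simpa using h))
    have h2 := Nat.le_of_dvd (by omega) (hdvd.trans h1)
    have h3 : 2 * (p ^ l + 1) ≤ (p ^ l - 1) * (p ^ l + 1) :=
      Nat.mul_le_mul_right _ (by omega)
    omega
  have hkn : (k - 1) * (p ^ l + 1) < n := by
    rw [Nat.le_div_iff_mul_le (by omega)] at hk'
    rw [Nat.sub_mul]
    have : 1 ≤ n := Nat.mul_pos hr hξ₂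
    omega
  have hkn' : k - 1 < n :=
    (Nat.le_mul_of_pos_right (k - 1) (Nat.succ_pos (p ^ l))).trans_lt hkn
  refine ⟨fun h hh => ?_, fun h hh => ?_, fun h hh => ?_⟩
  · obtain ⟨v, hv, hdim⟩ := exists_finrank_galoisHull_grsCode_succ ha' hw0 hsum α.ne_zero hβ hk
      hkn hh
    exact ⟨a, v, ha, hrange, hv, isMDSCode_grsCode hk (by omega) ha hv, hdim⟩
  · obtain ⟨v, hv, hdim⟩ := exists_finrank_galoisHull_grsCode ha' hw0 hsum α.ne_zero hβ hk hkn hh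
    exact ⟨_, v, ha', hrange', hv, isMDSCode_grsCode hk (by omega) ha' hv, hdim⟩
  · obtain ⟨v, hv, hdim⟩ := exists_finrank_galoisHull_extGrsCode ha' hw0 hsum α.ne_zero hβ hk
      hkn hh
    exact ⟨_, v, ha', hrange', hv, isMDSCode_extGrsCode hk (by omega) ha' hv, hdim⟩
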